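/- Let $k,\lambda,\beta>0$ and suppose that $\lambda/k=n$ is a positive integer. Let $X=(X(t))_{t\ge 0}$ be a $\Gamma$-OU$(k,\lambda,\beta)$ process, i.e. a solution of $$dX(t)=-kX(t)\,dt+dZ(t),\qquad\text{that is}\qquad X(t)=X(0)-k\int_0^tX(u)\,du+Z(t)\quad (t\ge 0)\ \text{a.s.},$$ where $Z(t)=\sum_{i=1}^{N(t)}J_i$ is a compound Poisson process, $N$ is a Poisson process with intensity $\lambda$, the jumps $J_i$ are i.i.d. exponential with rate $\beta$ and independent of $N$, and the initial value $X(0)$ is independent of $(N,(J_i)_i)$. Then for all $s\ge 0$ and $t>0$ the transition density of $X$ from time $s$ to time $t+s$ is $$p(x,t+s\mid y,s)=g_a(x-ay,n,\beta),\qquad a=e^{-kt},$$ where $$g_a(x,n,\beta)=a^n\,\delta(x)+\sum_{j=1}^n\binom nj a^{n-j}(1-a)^j f_{j,\beta}(x),\qquad f_{j,\beta}(x)=\frac{\beta^j x^{j-1}}{(j-1)!}e^{-\beta x}\mathbf 1_{\{x>0\}} .$$ That is, for almost every $y$ with respect to the law of $X(s)$, the regular conditional law of $X(t+s)$ given $X(s)=y$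 is $$a^n\,\delta_{ay}(dx)+\sum_{j=1}^n\binom nj a^{n-j}(1-a)^j f_{j,\beta}(x-ay)\,dx .$$ -/

import Mathlib

open MeasureTheory ProbabilityTheory Set
open scoped NNReal ENNReal

/-- `N` is a (homogeneous) Poisson process with intensity `lam` under `P`: a counting process with
nondecreasing right-continuous paths started at `0`, with independent increments, and with
`N t - N s` Poisson distributed with parameter `lam * (t - s)` for `s ≤ t`. -/
structure IsPoissonProcess {Ω : Type*} [MeasurableSpace Ω] (N : ℝ≥0 → Ω → ℕ) (lam : ℝ)
    (P : Measure Ω) : Prop where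
  measurable : ∀ t, Measurable (N t)
  zero : ∀ᵐ ω ∂P, N 0 ω = 0
  monotone : ∀ᵐ ω ∂P, Monotone (fun t => N t ω)
  rightContinuous : ∀ᵐ ω ∂P, ∀ t, ContinuousWithinAt (fun u => N u ω) (Ici t) t
  indepIncrements : HasIndepIncrements N P
  increment_law : ∀ s t : ℝ≥0, s ≤ t →
    HasLaw (fun ω => N t ω - N s ω) (poissonMeasure (lam * ((t : ℝ) - s)).toNNReal) P

/-- The compound sum `Z t = J₁ + ⋯ + J_{N t}`; the `i`-th jump, `i = 1, 2, …`, is `J (i - 1)`. -/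
def compoundSum {Ω : Type*} (N : ℝ≥0 → Ω → ℕ) (J : ℕ → Ω → ℝ) (t : ℝ≥0) (ω : Ω) : ℝ :=
  ∑ i ∈ Finset.range (N t ω), J i ω

/-- `N` and `J` are the number process and the jumps of a compound Poisson process with intensity
`lam` and exponentially distributed jumps with rate `β`. -/
structure IsExpCompoundPoisson {Ω : Type*} [MeasurableSpace Ω] (N : ℝ≥0 → Ω → ℕ) (J : ℕ → Ω → ℝ)
    (lam β : ℝ) (P : Measure Ω) : Prop where
  poisson : IsPoissonProcess N lam P
  jump_measurable : ∀ i, Measurable (J i)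
  jump_law : ∀ i, HasLaw (J i) (expMeasure β) P
  jump_indep : iIndepFun J P
  indep : IndepFun (fun ω t => N t ω) (fun ω i => J i ω) P

/-- `X` is a solution on `[0, ∞)` of `dX(t) = -k X(t) dt + dZ(t)`, i.e. almost surely
`X t = X 0 - k ∫₀ᵗ X u du + Z t` for all `t ≥ 0`. -/
def SolvesOU {Ω : Type*} [MeasurableSpace Ω] (k : ℝ) (Z X : ℝ≥0 → Ω → ℝ) (P : Measure Ω) : Prop :=
  ∀ᵐ ω ∂P, ∀ t : ℝ≥0,
    IntervalIntegrable (fun u : ℝ => X u.toNNReal ω) volume 0 t ∧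
    X t ω = X 0 ω - k * (∫ u in (0 : ℝ)..t, X u.toNNReal ω) + Z t ω

/-- `X` is a Γ-OU(`k`, `lam`, `β`) process: a solution of `dX(t) = -k X(t) dt + dZ(t)`, where `Z` is
a compound Poisson process with intensity `lam` and exponential jumps of rate `β`, and where the
initial value `X 0` is independent of the driving process. -/
def IsGammaOU {Ω : Type*} [MeasurableSpace Ω] (k lam β : ℝ) (X : ℝ≥0 → Ω → ℝ)
    (P : Measure Ω) : Prop :=
  (∀ t, Measurable (X t)) ∧
  ∃ (N : ℝ≥0 → Ω → ℕ) (J : ℕ → Ω → ℝ),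
    IsExpCompoundPoisson N J lam β P ∧
    IndepFun (X 0) (fun ω => ((fun t => N t ω, fun i => J i ω) : (ℝ≥0 → ℕ) × (ℕ → ℝ))) P ∧
    SolvesOU k (compoundSum N J) X P

/-- The absolutely continuous part `∑_{j=1}^n C(n,j) a^(n-j) (1-a)^j f_{j,β}(x)` of `g_a(x, n, β)`,
where `f_{j,β}` is the Erlang (gamma) density with shape `j` and rate `β`. -/
noncomputable def erlangMixtureDensity (a : ℝ) (n : ℕ) (β x : ℝ) : ℝ :=
  ∑ j ∈ Finset.Icc 1 n, (n.choose j : ℝ) * a ^ (n - j) * (1 - a) ^ j * gammaPDFReal (j : ℝ) β x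

/-- The measure with generalized density `x ↦ g_a(x - c, n, β)`, where
`g_a(x, n, β) = a^n δ(x) + ∑_{j=1}^n C(n,j) a^(n-j) (1-a)^j f_{j,β}(x)`. -/
noncomputable def erlangRemainderLaw (a : ℝ) (n : ℕ) (β c : ℝ) : Measure ℝ :=
  ENNReal.ofReal (a ^ n) • Measure.dirac c +
    volume.withDensity (fun x => ENNReal.ofReal (erlangMixtureDensity a n β (x - c)))

/-! Put `R = X(t+s) - a X(s)`. Everything follows from one identity: the joint characteristic
function of `(X(s), R)` is a product `H(η) B(ξ)` with `B(ξ) = ((β - iaξ)/(β - iξ))^n`. The product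
form gives independence of `X(s)` and `R`, so the conditional law of `X(t+s) = aX(s) + R` given
`X(s) = y` is the law of `ay + R`. Since `(β - iaξ)/(β - iξ) = a + (1-a) β/(β - iξ)`, the binomial
theorem identifies `B` as the characteristic function of the Erlang mixture.

The product form is obtained without stochastic integration. By variation of constants, `X(s) -
e^{-ks}X(0)` and `R` are pathwise Stieltjes integrals of exponentials against `Z`, hence limits of
weighted sums of increments of `Z` (`tendsto_sum_exp_mul_sub`). Such sums have an explicit
characteristic function: freeze the path of `N`, use that the jumps are i.i.d., then apply the
Poisson generating function to each increment
(`IsExpCompoundPoisson.integral_cexp_add_incrementSum`). In the limit each time interval contributes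
`exp(λ ∫ (φ(ξ e^{-ku}) - 1) du)`, with `φ` the exponential characteristic function. The integrand
has a logarithm as primitive, and `λ/k = n` turns the exponential into an `n`-th power
(`cexp_integral_charFun_expMeasure`). -/

/-! ### Characteristic functions of the Erlang laws and of their mixture. -/

lemma ofReal_sub_mul_I_ne_zero {β : ℝ} (hβ : 0 < β) (x : ℝ) : (β : ℂ) - x * Complex.I ≠ 0 := by
  intro h
  have := congrArg Complex.re h
  simp at this
  exact hβ.ne' this

lemma norm_pow_mul_cexp_neg {r : ℂ} (j : ℕ) {x : ℝ} (hx : 0 ≤ x) :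
    ‖(x : ℂ) ^ j * Complex.exp (-(r * x))‖ = x ^ j * Real.exp (-(r.re * x)) := by
  rw [norm_mul, norm_pow, Complex.norm_exp, Complex.norm_real, Real.norm_of_nonneg hx]
  simp

lemma integrableOn_pow_mul_cexp_neg {r : ℂ} (hr : 0 < r.re) (j : ℕ) :
    IntegrableOn (fun x : ℝ => (x : ℂ) ^ j * Complex.exp (-(r * x))) (Ioi 0) := by
  have h : IntegrableOn (fun x : ℝ => x ^ j * Real.exp (-(r.re * x))) (Ioi 0) := by
    have := integrableOn_rpow_mul_exp_neg_mul_rpow (s := (j : ℝ)) (p := 1) (b := r.re)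
      (by have : (0 : ℝ) ≤ j := j.cast_nonneg
          linarith) one_pos hr
    simpa using this
  refine Integrable.mono' h (by fun_prop) ?_
  filter_upwards [ae_restrict_mem measurableSet_Ioi] with x hx
  rw [norm_pow_mul_cexp_neg j (le_of_lt hx)]

lemma tendsto_pow_mul_cexp_neg_atTop {r : ℂ} (hr : 0 < r.re) (j : ℕ) :
    Filter.Tendsto (fun x : ℝ => (x : ℂ) ^ j * Complex.exp (-(r * x))) Filter.atTop (nhds 0) := by
  have h := tendsto_rpow_mul_exp_neg_mul_atTop_nhds_zero (j : ℝ) r.re hr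
  refine squeeze_zero_norm' ?_ h
  filter_upwards [Filter.eventually_ge_atTop 0] with x hx
  rw [norm_pow_mul_cexp_neg j hx]
  simp

/-- The Laplace transform of a monomial, at a complex argument with positive real part. -/
lemma integral_pow_mul_cexp_neg_Ioi {r : ℂ} (hr : 0 < r.re) (j : ℕ) :
    ∫ x in Ioi (0 : ℝ), (x : ℂ) ^ j * Complex.exp (-(r * x)) = j.factorial / r ^ (j + 1) := by
  have hr0 : r ≠ 0 := by rintro rfl; simp at hr
  induction j with
  | zero =>
    have := integral_exp_mul_complex_Ioi (a := -r) (by simpa using hr) 0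
    simpa [neg_mul] using this
  | succ j ih =>
    -- Integration by parts: this derivative integrates to zero over the half-line, which is the
    -- recursion in `j`.
    have hd : ∀ x : ℝ, HasDerivAt
        (fun x : ℝ => (x : ℂ) ^ (j + 1) * Complex.exp (-(r * x)))
        ((j + 1) * ((x : ℂ) ^ j * Complex.exp (-(r * x)))
          - r * ((x : ℂ) ^ (j + 1) * Complex.exp (-(r * x)))) x := by
      intro x
      have h1 := ((hasDerivAt_id x).ofReal_comp).pow (j + 1)
      have h2 := (((hasDerivAt_id x).ofReal_comp).const_mul r).neg.cexp
      convert! h1.mul h2 using 1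
      simp
      ring
    have key := integral_Ioi_of_hasDerivAt_of_tendsto' (a := (0 : ℝ)) (fun x _ => hd x)
      (((integrableOn_pow_mul_cexp_neg hr j).const_mul _).sub
        ((integrableOn_pow_mul_cexp_neg hr (j + 1)).const_mul _))
      (tendsto_pow_mul_cexp_neg_atTop hr (j + 1))
    rw [integral_sub ((integrableOn_pow_mul_cexp_neg hr j).const_mul _)
        ((integrableOn_pow_mul_cexp_neg hr (j + 1)).const_mul _),
      integral_const_mul, integral_const_mul, ih] at key
    simp only [Complex.ofReal_zero, ne_eq, Nat.add_eq_zero_iff, one_ne_zero, and_false,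
      not_false_eq_true, zero_pow, zero_mul, sub_zero] at key
    have e := sub_eq_zero.mp key
    rw [Nat.factorial_succ, pow_succ r (j + 1)]
    push_cast
    field_simp
    field_simp at e
    linear_combination -e

/-- The characteristic function of the Erlang distribution. -/
lemma charFun_gammaMeasure_natCast {β : ℝ} (hβ : 0 < β) {j : ℕ} (hj : 1 ≤ j) (ξ : ℝ) :
    charFun (gammaMeasure j β) ξ = (β / (β - ξ * Complex.I)) ^ j := by
  obtain ⟨j, rfl⟩ := Nat.exists_eq_add_of_le' hj
  have hpos : (0 : ℝ) < ((j + 1 : ℕ) : ℝ) := by positivity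
  have h1 : charFun (gammaMeasure ((j + 1 : ℕ) : ℝ) β) ξ
      = ∫ x, gammaPDFReal ((j + 1 : ℕ) : ℝ) β x • Complex.exp (x * ξ * Complex.I) := by
    rw [charFun_apply_real, gammaMeasure,
      integral_withDensity_eq_integral_toReal_smul₀ (by unfold gammaPDF; fun_prop)
        (by simp [gammaPDF])]
    refine integral_congr_ae (Filter.Eventually.of_forall fun x => ?_)
    simp only [gammaPDF, ENNReal.toReal_ofReal (gammaPDFReal_nonneg hpos hβ x)]
    rw [mul_comm (ξ : ℂ)]
  have h2 : ∫ x, gammaPDFReal ((j + 1 : ℕ) : ℝ) β x • Complex.exp (x * ξ * Complex.I)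
      = ∫ x in Ioi (0 : ℝ), gammaPDFReal ((j + 1 : ℕ) : ℝ) β x • Complex.exp (x * ξ * Complex.I) := by
    rw [← integral_Ici_eq_integral_Ioi, setIntegral_eq_integral_of_forall_compl_eq_zero]
    intro x hx
    simp only [mem_Ici, not_le] at hx
    simp [gammaPDFReal, not_le.2 hx]
  have h3 : ∫ x in Ioi (0 : ℝ), gammaPDFReal ((j + 1 : ℕ) : ℝ) β x • Complex.exp (x * ξ * Complex.I)
      = ∫ x in Ioi (0 : ℝ), ((β : ℂ) ^ (j + 1) / j.factorial) *
          ((x : ℂ) ^ j * Complex.exp (-((β - ξ * Complex.I) * x))) := by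
    refine setIntegral_congr_fun measurableSet_Ioi fun x hx => ?_
    have hx' : (0 : ℝ) ≤ x := le_of_lt hx
    have hexp : Complex.exp (-((β - ξ * Complex.I) * x))
        = Complex.exp (-(β * x)) * Complex.exp (x * ξ * Complex.I) := by
      rw [← Complex.exp_add]; ring_nf
    have hG : Real.Gamma ((j + 1 : ℕ) : ℝ) = j.factorial := by
      exact_mod_cast Real.Gamma_nat_eq_factorial j
    simp only [gammaPDFReal, if_pos hx', hG, Real.rpow_natCast, Complex.real_smul]
    have : ((j + 1 : ℕ) : ℝ) - 1 = j := by push_cast; ring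
    rw [this, Real.rpow_natCast, hexp]
    push_cast
    ring
  rw [h1, h2, h3, integral_const_mul, integral_pow_mul_cexp_neg_Ioi (by simpa using hβ)]
  have := ofReal_sub_mul_I_ne_zero hβ ξ
  have hf : (j.factorial : ℂ) ≠ 0 := by exact_mod_cast j.factorial_ne_zero
  rw [div_pow]
  field_simp

lemma charFun_expMeasure {β : ℝ} (hβ : 0 < β) (ξ : ℝ) :
    charFun (expMeasure β) ξ = β / (β - ξ * Complex.I) := by
  simpa [expMeasure] using charFun_gammaMeasure_natCast hβ le_rfl ξ

lemma withDensity_comp_sub_right (f : ℝ → ℝ≥0∞) (c : ℝ) :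
    volume.withDensity (fun x => f (x - c)) = (volume.withDensity f).map (· + c) := by
  ext s hs
  have hp : MeasurableSet ((· + c) ⁻¹' s) := (measurable_add_const c) hs
  rw [Measure.map_apply (measurable_add_const c) hs, withDensity_apply _ hs,
    withDensity_apply _ hp, ← lintegral_indicator hs, ← lintegral_indicator hp,
    ← lintegral_add_right_eq_self _ c]
  refine lintegral_congr fun x => ?_
  by_cases hx : x + c ∈ s <;> simp [Set.indicator, hx]

lemma withDensity_erlangMixtureDensity {a : ℝ} (ha0 : 0 ≤ a) (ha1 : a ≤ 1) (n : ℕ) {β : ℝ}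
    (hβ : 0 < β) :
    volume.withDensity (fun x => ENNReal.ofReal (erlangMixtureDensity a n β x)) =
      ∑ j ∈ Finset.Icc 1 n,
        ENNReal.ofReal (n.choose j * a ^ (n - j) * (1 - a) ^ j) • gammaMeasure j β := by
  have ha : 0 ≤ 1 - a := by linarith
  ext s hs
  have : (fun x => ENNReal.ofReal (erlangMixtureDensity a n β x)) = fun x =>
      ∑ j ∈ Finset.Icc 1 n,
        ENNReal.ofReal (n.choose j * a ^ (n - j) * (1 - a) ^ j) * gammaPDF j β x := by
    funext x
    rw [erlangMixtureDensity, ENNReal.ofReal_sum_of_nonneg]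
    · refine Finset.sum_congr rfl fun j _ => ?_
      rw [ENNReal.ofReal_mul (by positivity), gammaPDF]
    · intro j hj
      have hj' : (0 : ℝ) < j := by exact_mod_cast (Finset.mem_Icc.1 hj).1
      have := gammaPDFReal_nonneg hj' hβ x
      positivity
  have hm : ∀ j : ℕ, Measurable (gammaPDF j β) := fun j => by unfold gammaPDF; fun_prop
  rw [this, withDensity_apply _ hs, lintegral_finsetSum _ (fun j _ => (hm j).const_mul _)]
  simp only [Measure.coe_finsetSum, Finset.sum_apply, Measure.smul_apply, smul_eq_mul]
  refine Finset.sum_congr rfl fun j _ => ?_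
  rw [lintegral_const_mul _ (hm j), gammaMeasure, withDensity_apply _ hs]

lemma erlangRemainderLaw_eq {a : ℝ} (ha0 : 0 ≤ a) (ha1 : a ≤ 1) (n : ℕ) {β : ℝ}
    (hβ : 0 < β) (c : ℝ) :
    erlangRemainderLaw a n β c = (ENNReal.ofReal (a ^ n) • Measure.dirac 0 +
      ∑ j ∈ Finset.Icc 1 n,
        ENNReal.ofReal (n.choose j * a ^ (n - j) * (1 - a) ^ j) • gammaMeasure j β).map (· + c) := by
  rw [erlangRemainderLaw, withDensity_comp_sub_right (fun x => ENNReal.ofReal (erlangMixtureDensity a n β x)),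
    withDensity_erlangMixtureDensity ha0 ha1 n hβ, Measure.map_add _ _ (measurable_add_const c),
    Measure.map_smul, Measure.map_dirac' (measurable_add_const c), zero_add]

/-- Finiteness is what uniqueness of characteristic functions requires; that the mass is one need
not be computed. -/
lemma isFiniteMeasure_erlangRemainderLaw {a : ℝ} (ha0 : 0 ≤ a) (ha1 : a ≤ 1) (n : ℕ) {β : ℝ}
    (hβ : 0 < β) (c : ℝ) : IsFiniteMeasure (erlangRemainderLaw a n β c) := by
  rw [erlangRemainderLaw_eq ha0 ha1 n hβ]
  have : IsFiniteMeasure (∑ j ∈ Finset.Icc 1 n,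
      ENNReal.ofReal (n.choose j * a ^ (n - j) * (1 - a) ^ j) • gammaMeasure j β) := by
    refine ⟨?_⟩
    simp only [Measure.coe_finsetSum, Finset.sum_apply, Measure.smul_apply, smul_eq_mul]
    refine ENNReal.sum_lt_top.2 fun j hj => ?_
    have := isProbabilityMeasure_gammaMeasure (a := j) (r := β)
      (by exact_mod_cast (Finset.mem_Icc.1 hj).1) hβ
    simp
  have := (Measure.dirac (0 : ℝ)).smul_finite (c := ENNReal.ofReal (a ^ n)) ENNReal.ofReal_ne_top
  infer_instance

/-- The characteristic function of the Erlang remainder law. -/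
lemma charFun_erlangRemainderLaw {a : ℝ} (ha0 : 0 ≤ a) (ha1 : a ≤ 1) (n : ℕ) {β : ℝ}
    (hβ : 0 < β) (c ξ : ℝ) :
    charFun (erlangRemainderLaw a n β c) ξ =
      ((β - a * ξ * Complex.I) / (β - ξ * Complex.I)) ^ n * Complex.exp (c * ξ * Complex.I) := by
  have ha : 0 ≤ 1 - a := by linarith
  have hint : ∀ (μ : Measure ℝ) [IsFiniteMeasure μ],
      Integrable (fun x : ℝ => Complex.exp (ξ * x * Complex.I)) μ := by
    intro μ _
    refine Integrable.of_bound (by fun_prop) 1 (Filter.Eventually.of_forall fun x => ?_)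
    rw [← Complex.ofReal_mul, Complex.norm_exp_ofReal_mul_I]
  have hfin : ∀ j ∈ Finset.Icc 1 n, IsFiniteMeasure
      (ENNReal.ofReal (n.choose j * a ^ (n - j) * (1 - a) ^ j) • gammaMeasure j β) := by
    intro j hj
    have := isProbabilityMeasure_gammaMeasure (a := j) (r := β)
      (by exact_mod_cast (Finset.mem_Icc.1 hj).1) hβ
    exact Measure.smul_finite _ ENNReal.ofReal_ne_top
  have hint' : ∀ j ∈ Finset.Icc 1 n, Integrable (fun x : ℝ => Complex.exp (ξ * x * Complex.I))
      (ENNReal.ofReal (n.choose j * a ^ (n - j) * (1 - a) ^ j) • gammaMeasure j β) := by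
    intro j hj
    have := hfin j hj
    exact hint _
  have := (Measure.dirac (0 : ℝ)).smul_finite (c := ENNReal.ofReal (a ^ n)) ENNReal.ofReal_ne_top
  rw [erlangRemainderLaw_eq ha0 ha1 n hβ, charFun_map_add_const, charFun_apply_real,
    integral_add_measure (hint _) (integrable_finsetSum_measure.2 hint'),
    integral_finsetSum_measure hint']
  have hne := ofReal_sub_mul_I_ne_zero hβ ξ
  congr 1
  -- The `n`-th power of a two-point mixture of a unit mass at zero and an exponential law; the
  -- exponent `j` of the second term is the Erlang shape.
  · have h0 : ((β : ℂ) - a * ξ * Complex.I) / (β - ξ * Complex.I)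
        = (1 - a : ℂ) * (β / (β - ξ * Complex.I)) + a := by
      field_simp
      ring
    rw [h0, add_pow, Finset.range_eq_Ico, Finset.sum_eq_sum_Ico_succ_bot (by omega), zero_add]
    congr 1
    · simp [integral_smul_measure, ENNReal.toReal_ofReal (pow_nonneg ha0 n)]
    · refine Finset.sum_congr (by ext; simp) fun j hj => ?_
      have hj1 : 1 ≤ j := by simp at hj; exact hj.1
      rw [integral_smul_measure, ← charFun_apply_real, charFun_gammaMeasure_natCast hβ hj1,
        ENNReal.toReal_ofReal (by positivity), Complex.real_smul, mul_pow]
      push_cast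
      ring
  · simp [mul_comm]

/-! ### Characteristic functions of increments of the compound Poisson process. -/

lemma IndepFun.integral_comp_prodMk_eq_integral_integral {Ω 𝓧 𝓨 : Type*} [MeasurableSpace Ω]
    [MeasurableSpace 𝓧] [MeasurableSpace 𝓨] {P : Measure Ω} [IsProbabilityMeasure P]
    {A : Ω → 𝓧} {B : Ω → 𝓨} (hAB : IndepFun A B P) (hA : Measurable A) (hB : Measurable B)
    {F : 𝓧 × 𝓨 → ℂ} (hF : Measurable F) (hbound : ∀ p, ‖F p‖ ≤ 1) :
    ∫ ω, F (A ω, B ω) ∂P = ∫ ω, ∫ ω', F (A ω, B ω') ∂P ∂P := by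
  have hmap := (indepFun_iff_map_prod_eq_prod_map_map hA.aemeasurable hB.aemeasurable).1 hAB
  have := Measure.isProbabilityMeasure_map (μ := P) hA.aemeasurable
  have := Measure.isProbabilityMeasure_map (μ := P) hB.aemeasurable
  have hint : Integrable F ((P.map A).prod (P.map B)) :=
    Integrable.of_bound hF.aestronglyMeasurable 1 (Filter.Eventually.of_forall hbound)
  rw [← integral_map (φ := fun ω => (A ω, B ω)) (hA.prodMk hB).aemeasurable
    hF.aestronglyMeasurable, hmap, integral_prod _ hint,
    integral_map hA.aemeasurable
      (hF.stronglyMeasurable.integral_prod_right' (ν := P.map B)).aestronglyMeasurable]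
  refine integral_congr_ae (Filter.Eventually.of_forall fun ω => ?_)
  exact integral_map hB.aemeasurable (hF.comp measurable_prodMk_left).aestronglyMeasurable

/-- The probability generating function of the Poisson distribution. -/
lemma integral_pow_poissonMeasure (r : ℝ≥0) (z : ℂ) :
    ∫ n, z ^ n ∂(poissonMeasure r) = Complex.exp (r * (z - 1)) := by
  rw [integral_poissonMeasure]
  have h : ∀ n : ℕ, (Real.exp (-r) * (r : ℝ) ^ n / n.factorial) • z ^ n
      = Complex.exp (-r) * ((r * z) ^ n / n.factorial) := by
    intro n
    rw [Complex.real_smul, mul_pow]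
    push_cast
    ring
  simp_rw [h]
  rw [tsum_mul_left, ← congrFun NormedSpace.exp_eq_tsum_div (r * z : ℂ), ← Complex.exp_eq_exp_ℂ,
    ← Complex.exp_add]
  ring_nf

lemma sum_range_sum_Ico_eq {c : ℕ → ℕ} (hc : Monotone c) {E : Type*} [AddCommMonoid E]
    (g : ℕ → E) (M : ℕ) :
    ∑ i ∈ Finset.range M, ∑ j ∈ Finset.Ico (c i) (c (i + 1)), g j =
      ∑ j ∈ Finset.Ico (c 0) (c M), g j := by
  induction M with
  | zero => simp
  | succ M ih =>
    rw [Finset.sum_range_succ, ih, Finset.sum_Ico_consecutive _ (hc (Nat.zero_le _)) (hc M.le_succ)]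

/-- The weight attached to `j` by the partition into blocks `[c i, c (i + 1))` of weight `w i`. -/
noncomputable def blockWeight (c : ℕ → ℕ) (w : ℕ → ℝ) (M j : ℕ) : ℝ :=
  ∑ i ∈ Finset.range M, if c i ≤ j ∧ j < c (i + 1) then w i else 0

lemma blockWeight_eq {c : ℕ → ℕ} (hc : Monotone c) (w : ℕ → ℝ) {M i j : ℕ} (hi : i < M)
    (hj : j ∈ Finset.Ico (c i) (c (i + 1))) : blockWeight c w M j = w i := by
  rw [Finset.mem_Ico] at hj
  rw [blockWeight, Finset.sum_eq_single i, if_pos hj]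
  · intro i' _ hne
    refine if_neg fun h => ?_
    rcases lt_or_gt_of_ne hne with h' | h'
    · have : c (i' + 1) ≤ c i := hc h'
      omega
    · have : c (i + 1) ≤ c i' := hc h'
      omega
  · intro h
    exact absurd (Finset.mem_range.2 hi) h

/-- The characteristic function of a blockwise weighted sum of i.i.d. variables. -/
lemma integral_cexp_sum_block {Ω : Type*} [MeasurableSpace Ω] {P : Measure Ω}
    {J : ℕ → Ω → ℝ} {μ : Measure ℝ} (hJm : ∀ i, Measurable (J i)) (hlaw : ∀ i, HasLaw (J i) μ P)
    (hind : iIndepFun J P) {c : ℕ → ℕ} (hc : Monotone c) (w : ℕ → ℝ) (M : ℕ) :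
    ∫ ω, Complex.exp ((∑ i ∈ Finset.range M, w i * (∑ j ∈ Finset.range (c (i + 1)), J j ω -
        ∑ j ∈ Finset.range (c i), J j ω) : ℝ) * Complex.I) ∂P =
      ∏ i ∈ Finset.range M, charFun μ (w i) ^ (c (i + 1) - c i) := by
  have hsum : ∀ ω, ∑ i ∈ Finset.range M, w i * (∑ j ∈ Finset.range (c (i + 1)), J j ω -
        ∑ j ∈ Finset.range (c i), J j ω) =
      ∑ j ∈ Finset.Ico (c 0) (c M), blockWeight c w M j * J j ω := by
    intro ω
    rw [← sum_range_sum_Ico_eq hc]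
    refine Finset.sum_congr rfl fun i hi => ?_
    rw [← Finset.sum_Ico_eq_sub _ (hc i.le_succ), Finset.mul_sum]
    refine Finset.sum_congr rfl fun j hj => ?_
    rw [blockWeight_eq hc w (Finset.mem_range.1 hi) hj]
  have hprod : ∏ j ∈ Finset.Ico (c 0) (c M), charFun μ (blockWeight c w M j) =
      ∏ i ∈ Finset.range M, charFun μ (w i) ^ (c (i + 1) - c i) := by
    -- The block decomposition of sums, read in `Additive ℂ`, is the one for products.
    have := sum_range_sum_Ico_eq hc
      (fun j => Additive.ofMul (charFun μ (blockWeight c w M j))) M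
    refine (congrArg Additive.toMul this).symm.trans ?_
    simp only [toMul_sum, toMul_ofMul]
    refine Finset.prod_congr rfl fun i hi => ?_
    rw [Finset.prod_congr rfl fun j hj => by
      rw [blockWeight_eq hc w (Finset.mem_range.1 hi) hj], Finset.prod_const, Nat.card_Ico]
  have hindw : iIndepFun (fun (j : ℕ) ω => blockWeight c w M j * J j ω) P :=
    hind.comp (fun j x => blockWeight c w M j * x) fun j => measurable_const_mul _
  have hm : ∀ j, Measurable fun ω => blockWeight c w M j * J j ω := fun j => (hJm j).const_mul _
  have hchar := (hindw.restrict (Finset.Ico (c 0) (c M))).charFun_map_fun_finsetSum_eq_prod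
    (fun j _ => (hm j).aemeasurable)
  have h1 := congrFun hchar 1
  rw [charFun_apply_real, integral_map (Finset.measurable_sum _ fun j _ => hm j).aemeasurable
    (by fun_prop)] at h1
  simp_rw [hsum]
  rw [← hprod]
  convert h1 using 1
  · simp
  · rw [Finset.prod_apply]
    refine Finset.prod_congr rfl fun j _ => ?_
    rw [charFun_map_mul_comp (hJm j).aemeasurable, (hlaw j).map_eq, mul_one]

/-- Independence of the increments splits the expectation, and each factor is a Poisson generating
function. -/
lemma IsPoissonProcess.integral_prod_pow_sub {Ω : Type*} [MeasurableSpace Ω] {P : Measure Ω}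
    {N : ℝ≥0 → Ω → ℕ} {lam : ℝ} (hN : IsPoissonProcess N lam P) (hlam : 0 ≤ lam) {τ : ℕ → ℝ≥0}
    (hτ : Monotone τ) (z : ℕ → ℂ) (M : ℕ) :
    ∫ ω, ∏ i ∈ Finset.range M, z i ^ (N (τ (i + 1)) ω - N (τ i) ω) ∂P =
      ∏ i ∈ Finset.range M, Complex.exp (lam * ((τ (i + 1) : ℝ) - τ i : ℝ) * (z i - 1)) := by
  simp_rw [Finset.prod_range]
  have hind := hN.indepIncrements M (fun i => τ i) (fun i j h => hτ h)
  have := hind.integral_fun_prod_comp (𝕜 := ℂ) (f := fun (i : Fin M) (n : ℕ) => z i ^ n)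
    (fun i => ((hN.measurable _).sub (hN.measurable _)).aemeasurable)
    (fun i => Measurable.of_discrete.aestronglyMeasurable)
  simp only [Fin.val_succ, Fin.val_castSucc] at this
  rw [this]
  refine Finset.prod_congr rfl fun i _ => ?_
  have hle : τ i ≤ τ (i + 1) := hτ (Nat.le_succ _)
  have hlaw := hN.increment_law _ _ hle
  rw [← integral_map (φ := fun ω => N (τ (i + 1)) ω - N (τ i) ω) (f := fun n : ℕ => z i ^ n)
    hlaw.aemeasurable Measurable.of_discrete.aestronglyMeasurable, hlaw.map_eq,
    integral_pow_poissonMeasure]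
  have h0 : 0 ≤ lam * ((τ (i + 1) : ℝ) - τ i) :=
    mul_nonneg hlam (sub_nonneg.2 (by exact_mod_cast hle))
  congr 2
  rw [← Complex.ofReal_mul]
  congr 1
  exact Real.coe_toNNReal _ h0

lemma measurable_sum_range_uncurry :
    Measurable fun p : ℕ × (ℕ → ℝ) => ∑ j ∈ Finset.range p.1, p.2 j :=
  measurable_from_prod_countable_right fun n =>
    Finset.measurable_sum (Finset.range n) fun j _ => measurable_pi_apply j

lemma IsExpCompoundPoisson.measurable_prodMk {Ω : Type*} [MeasurableSpace Ω] {P : Measure Ω}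
    {N : ℝ≥0 → Ω → ℕ} {J : ℕ → Ω → ℝ} {lam β : ℝ} (h : IsExpCompoundPoisson N J lam β P) :
    Measurable fun ω => ((fun t => N t ω, fun i => J i ω) : (ℝ≥0 → ℕ) × (ℕ → ℝ)) :=
  (measurable_pi_lambda _ h.poisson.measurable).prodMk (measurable_pi_lambda _ h.jump_measurable)

/-- The linear combination of increments of a compound sum, as a functional of the number path
and the jumps. -/
noncomputable def incrementSum (τ : ℕ → ℝ≥0) (w : ℕ → ℝ) (M : ℕ)
    (p : (ℝ≥0 → ℕ) × (ℕ → ℝ)) : ℝ :=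
  ∑ i ∈ Finset.range M, w i * (∑ j ∈ Finset.range (p.1 (τ (i + 1))), p.2 j -
    ∑ j ∈ Finset.range (p.1 (τ i)), p.2 j)

lemma measurable_incrementSum (τ : ℕ → ℝ≥0) (w : ℕ → ℝ) (M : ℕ) :
    Measurable (incrementSum τ w M) := by
  have h : ∀ t : ℝ≥0, Measurable fun p : (ℝ≥0 → ℕ) × (ℕ → ℝ) =>
      ∑ j ∈ Finset.range (p.1 t), p.2 j := fun t =>
    measurable_sum_range_uncurry.comp (f := fun p : (ℝ≥0 → ℕ) × (ℕ → ℝ) => (p.1 t, p.2))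
      (((measurable_pi_apply t).comp measurable_fst).prodMk measurable_snd)
  exact Finset.measurable_sum _ fun i _ => ((h _).sub (h _)).const_mul _

/-- By independence the path of `N` can be frozen while integrating over the jumps. A block with `m`
jumps then contributes `φ(w i)^m`, and averaging over `N` evaluates a generating function at `z i =
φ(w i)`. -/
lemma IsExpCompoundPoisson.integral_cexp_incrementSum {Ω : Type*} [MeasurableSpace Ω]
    {P : Measure Ω} [IsProbabilityMeasure P] {N : ℝ≥0 → Ω → ℕ} {J : ℕ → Ω → ℝ} {lam β : ℝ}
    (h : IsExpCompoundPoisson N J lam β P) (hlam : 0 ≤ lam) {τ : ℕ → ℝ≥0} (hτ : Monotone τ)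
    (w : ℕ → ℝ) (M : ℕ) :
    ∫ ω, Complex.exp (incrementSum τ w M (fun t => N t ω, fun i => J i ω) * Complex.I) ∂P =
      ∏ i ∈ Finset.range M,
        Complex.exp (lam * ((τ (i + 1) : ℝ) - τ i : ℝ) * (charFun (expMeasure β) (w i) - 1)) := by
  rw [← h.poisson.integral_prod_pow_sub hlam hτ,
    IndepFun.integral_comp_prodMk_eq_integral_integral h.indep
    (measurable_pi_lambda _ h.poisson.measurable) (measurable_pi_lambda _ h.jump_measurable)
    (F := fun p => Complex.exp (incrementSum τ w M p * Complex.I))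
    (by have := measurable_incrementSum τ w M
        fun_prop)
    (fun p => (Complex.norm_exp_ofReal_mul_I _).le)]
  refine integral_congr_ae ?_
  filter_upwards [h.poisson.monotone] with ω hω
  exact integral_cexp_sum_block h.jump_measurable h.jump_law h.jump_indep (hω.comp hτ) w M

/-- The joint characteristic function of an independent initial value and finitely many
increments of a compound Poisson process. -/
lemma IsExpCompoundPoisson.integral_cexp_add_incrementSum {Ω : Type*} [MeasurableSpace Ω]
    {P : Measure Ω} [IsProbabilityMeasure P] {N : ℝ≥0 → Ω → ℕ} {J : ℕ → Ω → ℝ} {lam β : ℝ}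
    (h : IsExpCompoundPoisson N J lam β P) (hlam : 0 ≤ lam) {Y : Ω → ℝ} (hY : Measurable Y)
    (hind : IndepFun Y
      (fun ω => ((fun t => N t ω, fun i => J i ω) : (ℝ≥0 → ℕ) × (ℕ → ℝ))) P)
    {τ : ℕ → ℝ≥0} (hτ : Monotone τ) (η : ℝ) (w : ℕ → ℝ) (M : ℕ) :
    ∫ ω, Complex.exp ((η * Y ω + incrementSum τ w M (fun t => N t ω, fun i => J i ω) : ℝ) *
        Complex.I) ∂P =
      charFun (P.map Y) η * ∏ i ∈ Finset.range M,
        Complex.exp (lam * ((τ (i + 1) : ℝ) - τ i : ℝ) * (charFun (expMeasure β) (w i) - 1)) := by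
  have hm := measurable_incrementSum τ w M
  have key := hind.integral_fun_comp_mul_comp (𝕜 := ℂ)
    (f := fun y : ℝ => Complex.exp (η * y * Complex.I))
    (g := fun p : (ℝ≥0 → ℕ) × (ℕ → ℝ) => Complex.exp (incrementSum τ w M p * Complex.I))
    hY.aemeasurable h.measurable_prodMk.aemeasurable (by fun_prop)
    (Measurable.aestronglyMeasurable (by fun_prop))
  rw [h.integral_cexp_incrementSum hlam hτ w M] at key
  rw [charFun_apply_real, integral_map hY.aemeasurable (by fun_prop), ← key]
  refine integral_congr_ae (Filter.Eventually.of_forall fun ω => ?_)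
  simp only [← Complex.exp_add]
  push_cast
  ring_nf

/-! ### Stieltjes sums and the pathwise solution of the equation. -/

/-- The right endpoint of the cell containing `u` in the partition of `[0, T]` into `M` cells. -/
noncomputable def gridCeil (T : ℝ) (M : ℕ) (u : ℝ) : ℝ := T * ⌈u * M / T⌉₊ / M

lemma measurable_gridCeil (T : ℝ) (M : ℕ) : Measurable (gridCeil T M) := by
  unfold gridCeil
  fun_prop

lemma le_gridCeil {T : ℝ} (hT : 0 < T) {M : ℕ} (hM : 0 < M) (u : ℝ) : u ≤ gridCeil T M u := by
  have hM' : (0 : ℝ) < M := by exact_mod_cast hM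
  have := Nat.le_ceil (u * M / T)
  rw [div_le_iff₀ hT] at this
  rw [gridCeil, le_div_iff₀ hM']
  linarith

lemma gridCeil_le_add {T : ℝ} (hT : 0 < T) {M : ℕ} (hM : 0 < M) {u : ℝ} (hu : 0 ≤ u) :
    gridCeil T M u ≤ u + T / M := by
  have hM' : (0 : ℝ) < M := by exact_mod_cast hM
  have := (Nat.ceil_lt_add_one (a := u * M / T) (by positivity)).le
  rw [gridCeil]
  calc T * ⌈u * M / T⌉₊ / M ≤ T * (u * M / T + 1) / M := by gcongr
    _ = u + T / M := by field_simp

lemma gridCeil_eq {T : ℝ} (hT : 0 < T) {M : ℕ} (hM : 0 < M) {i : ℕ} {u : ℝ}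
    (h1 : T * i / M < u) (h2 : u ≤ T * (i + 1 : ℕ) / M) :
    gridCeil T M u = T * (i + 1 : ℕ) / M := by
  have hM' : (0 : ℝ) < M := by exact_mod_cast hM
  have : ⌈u * M / T⌉₊ = i + 1 := by
    rw [Nat.ceil_eq_iff (Nat.succ_ne_zero i), Nat.succ_sub_one, lt_div_iff₀ hT, div_le_iff₀ hT]
    rw [div_lt_iff₀ hM'] at h1
    rw [le_div_iff₀ hM'] at h2
    exact ⟨by linarith, by linarith⟩
  rw [gridCeil, this]

lemma gridCeil_le {T : ℝ} (hT : 0 < T) {M : ℕ} (hM : 0 < M) {u : ℝ} (hu : u ≤ T) :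
    gridCeil T M u ≤ T := by
  have hM' : (0 : ℝ) < M := by exact_mod_cast hM
  have : ⌈u * M / T⌉₊ ≤ M := by
    rw [Nat.ceil_le, div_le_iff₀ hT]
    nlinarith
  rw [gridCeil, div_le_iff₀ hM']
  have : (⌈u * M / T⌉₊ : ℝ) ≤ M := by exact_mod_cast this
  gcongr

lemma tendsto_gridCeil {T : ℝ} (hT : 0 < T) {u : ℝ} (hu : 0 ≤ u) :
    Filter.Tendsto (fun m : ℕ => gridCeil T (m + 1) u) Filter.atTop (nhdsWithin u (Ici u)) := by
  refine tendsto_nhdsWithin_iff.2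
    ⟨?_, Filter.Eventually.of_forall fun m => le_gridCeil hT m.succ_pos u⟩
  have h : Filter.Tendsto (fun m : ℕ => u + T / ((m + 1 : ℕ) : ℝ)) Filter.atTop (nhds (u + 0)) :=
    tendsto_const_nhds.add
      ((tendsto_const_div_atTop_nhds_zero_nat T).comp (Filter.tendsto_add_atTop_nat 1))
  rw [add_zero] at h
  exact tendsto_of_tendsto_of_tendsto_of_le_of_le tendsto_const_nhds h
    (fun m => le_gridCeil hT m.succ_pos u) (fun m => gridCeil_le_add hT m.succ_pos hu)

/-- Riemann–Stieltjes sums of a right-continuous function along uniform partitions, evaluated at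
right endpoints, converge to the integral against the derivative of the integrator. -/
lemma tendsto_sum_sub_smul {E : Type*} [NormedAddCommGroup E] [NormedSpace ℝ E] [CompleteSpace E]
    {T : ℝ} (hT : 0 ≤ T) {W h : ℝ → ℝ} (hW : ∀ u, HasDerivAt W (h u) u) (hh : Continuous h)
    {g : ℝ → E} (hgm : StronglyMeasurable g) {C : ℝ} (hgC : ∀ u ∈ Icc 0 T, ‖g u‖ ≤ C)
    (hgr : ∀ u ∈ Icc 0 T, ContinuousWithinAt g (Ici u) u) :
    Filter.Tendsto (fun m : ℕ => ∑ i ∈ Finset.range (m + 1),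
        (W (T * (i + 1 : ℕ) / (m + 1 : ℕ)) - W (T * i / (m + 1 : ℕ))) •
          g (T * (i + 1 : ℕ) / (m + 1 : ℕ)))
      Filter.atTop (nhds (∫ u in (0 : ℝ)..T, h u • g u)) := by
  rcases hT.eq_or_lt with rfl | hT
  -- The degenerate interval is separated because `gridCeil` divides by `T`.
  · simp
  have hsm : ∀ m : ℕ, StronglyMeasurable fun u => h u • g (gridCeil T (m + 1) u) := fun m =>
    hh.stronglyMeasurable.smul (hgm.comp_measurable (measurable_gridCeil T (m + 1)))
  have hbound : ∀ m : ℕ, ∀ u ∈ uIoc (0 : ℝ) T, ‖h u • g (gridCeil T (m + 1) u)‖ ≤ ‖h u‖ * C := by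
    intro m u hu
    rw [uIoc_of_le hT.le] at hu
    rw [norm_smul]
    gcongr
    exact hgC _ ⟨hu.1.le.trans (le_gridCeil hT m.succ_pos u), gridCeil_le hT m.succ_pos hu.2⟩
  have hbi : IntervalIntegrable (fun u => ‖h u‖ * C) volume 0 T :=
    (hh.norm.mul continuous_const).intervalIntegrable _ _
  have hii : ∀ m : ℕ, IntervalIntegrable (fun u => h u • g (gridCeil T (m + 1) u)) volume 0 T :=
    fun m => hbi.mono_fun' (hsm m).aestronglyMeasurable
      ((ae_restrict_iff' measurableSet_uIoc).2 (Filter.Eventually.of_forall (hbound m)))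
  have hlim : Filter.Tendsto (fun m : ℕ => ∫ u in (0 : ℝ)..T, h u • g (gridCeil T (m + 1) u))
      Filter.atTop (nhds (∫ u in (0 : ℝ)..T, h u • g u)) := by
    refine intervalIntegral.tendsto_integral_filter_of_dominated_convergence (fun u => ‖h u‖ * C)
      (Filter.Eventually.of_forall fun m => (hsm m).aestronglyMeasurable)
      (Filter.Eventually.of_forall fun m => Filter.Eventually.of_forall (hbound m)) hbi
      (Filter.Eventually.of_forall fun u hu => ?_)
    rw [uIoc_of_le hT.le] at hu
    -- Right endpoints approach `u` from the right, so right continuity of `g` suffices.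
    exact tendsto_const_nhds.smul
      ((hgr u ⟨hu.1.le, hu.2⟩).tendsto.comp (tendsto_gridCeil hT hu.1.le))
  -- On each cell `g ∘ gridCeil` is constant, so the sum equals the integral of `h • g ∘ gridCeil`
  -- exactly.
  refine hlim.congr fun m => ?_
  have hM : (0 : ℝ) < ((m + 1 : ℕ) : ℝ) := by positivity
  have hmono : ∀ i : ℕ, T * i / (m + 1 : ℕ) ≤ T * (i + 1 : ℕ) / (m + 1 : ℕ) := by
    intro i
    gcongr
    exact i.le_succ
  have hsub : ∀ i < m + 1,
      Icc (T * i / (m + 1 : ℕ)) (T * (i + 1 : ℕ) / (m + 1 : ℕ)) ⊆ Icc 0 T := by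
    intro i hi
    refine Icc_subset_Icc (by positivity) ?_
    rw [div_le_iff₀ hM]
    gcongr
    exact Nat.lt_succ_iff.1 hi
  have hadj := intervalIntegral.sum_integral_adjacent_intervals (μ := volume)
    (f := fun u => h u • g (gridCeil T (m + 1) u))
    (a := fun i : ℕ => T * i / (m + 1 : ℕ)) (n := m + 1) (fun i hi => (hii m).mono_set (by
      rw [uIcc_of_le (hmono i), uIcc_of_le hT.le]
      exact hsub i hi))
  have e0 : T * ((0 : ℕ) : ℝ) / (m + 1 : ℕ) = 0 := by simp
  have eT : T * ((m + 1 : ℕ) : ℝ) / (m + 1 : ℕ) = T := by field_simp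
  rw [e0, eT] at hadj
  rw [← hadj]
  refine Finset.sum_congr rfl fun i _ => ?_
  rw [intervalIntegral.integral_congr_ae (g := fun u => h u • g (T * (i + 1 : ℕ) / (m + 1 : ℕ))),
    intervalIntegral.integral_smul_const,
    intervalIntegral.integral_eq_sub_of_hasDerivAt (fun u _ => hW u) (hh.intervalIntegrable _ _)]
  refine Filter.Eventually.of_forall fun u hu => ?_
  rw [uIoc_of_le (hmono i)] at hu
  simp only [gridCeil_eq hT m.succ_pos hu.1 hu.2]

/-- The variation of constants formula for `dx = -k x dt + dz` with right-continuous `z`. -/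
lemma sub_exp_mul_eq_of_integral_equation {k : ℝ} {z x : ℝ → ℝ}
    (hz : ∀ u, 0 ≤ u → ContinuousWithinAt z (Ioi u) u)
    (hx : ∀ t, 0 ≤ t → IntervalIntegrable x volume 0 t ∧
      x t = x 0 - k * (∫ u in (0 : ℝ)..t, x u) + z t)
    {s t : ℝ} (hs : 0 ≤ s) (ht : 0 ≤ t) :
    x (s + t) - Real.exp (-k * t) * x s = z (s + t) - Real.exp (-k * t) * z s -
      ∫ u in (0 : ℝ)..t, k * Real.exp (-k * (t - u)) * z (s + u) := by
  have hst : s ≤ s + t := by linarith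
  -- Removing `z` leaves a continuous function with right derivative `-k x`, although `x` itself
  -- jumps. Then `e^{ku} Y` has right derivative `-k e^{ku} z`, which no longer involves `x`.
  set Y : ℝ → ℝ := fun u => x 0 - k * ∫ v in (0 : ℝ)..u, x v with hY
  have hxY : ∀ u, 0 ≤ u → x u = Y u + z u := fun u hu => (hx u hu).2
  have hprim : ContinuousOn (fun u => ∫ v in (0 : ℝ)..u, x v) (Icc 0 (s + t + 1)) := by
    have h0 : (0 : ℝ) ≤ s + t + 1 := by linarith
    have := intervalIntegral.continuousOn_primitive_interval (μ := volume) (a := 0) (b := s + t + 1)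
      (f := x) (by
        rw [uIcc_of_le h0]
        exact (intervalIntegrable_iff_integrableOn_Icc_of_le h0).1 (hx _ h0).1)
    rwa [uIcc_of_le h0] at this
  have hYc : ContinuousOn Y (Icc 0 (s + t + 1)) := continuousOn_const.sub (hprim.const_mul k)
  have hxr : ∀ u ∈ Ioo s (s + t), ContinuousWithinAt x (Ioi u) u := by
    intro u hu
    have hu0 : 0 ≤ u := hs.trans hu.1.le
    have h1 : ContinuousWithinAt Y (Ioi u) u :=
      (hYc.continuousAt (Icc_mem_nhds (by linarith [hu.1]) (by linarith [hu.2]))).continuousWithinAt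
    refine (h1.add (hz u hu0)).congr (fun v hv => hxY v (hu0.trans (le_of_lt hv))) (hxY u hu0)
  have hder : ∀ u ∈ Ioo s (s + t), HasDerivWithinAt (fun u => Real.exp (k * u) * Y u)
      (-(k * Real.exp (k * u) * z u)) (Ioi u) u := by
    intro u hu
    have hu0 : 0 ≤ u := hs.trans hu.1.le
    have h1 : HasDerivWithinAt (fun u => ∫ v in (0 : ℝ)..u, x v) (x u) (Ioi u) u := by
      refine (intervalIntegral.integral_hasDerivWithinAt_right (hx u hu0).1 (s := Ici u)
        (t := Ioi u) ?_ (hxr u hu)).mono Ioi_subset_Ici_self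
      refine ⟨Ioc u (s + t), Ioc_mem_nhdsGT hu.2, ?_⟩
      have h2 := (hx (s + t) (by linarith)).1.aestronglyMeasurable
      exact h2.mono_measure (Measure.restrict_mono (Ioc_subset_Ioc_left hu0) le_rfl)
    have h3 : HasDerivWithinAt Y (-(k * x u)) (Ioi u) u := by
      simpa using (h1.const_mul k).const_sub (x 0)
    have h4 : HasDerivWithinAt (fun u => Real.exp (k * u)) (k * Real.exp (k * u)) (Ioi u) u := by
      have := ((hasDerivAt_id u).const_mul k).exp
      simp only [id, mul_one] at this
      rw [mul_comm]
      exact this.hasDerivWithinAt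
    convert! h4.mul h3 using 1
    rw [hxY u hu0]
    ring
  have hYs : ContinuousOn Y (Icc s (s + t)) := hYc.mono (Icc_subset_Icc hs (by linarith))
  have hzi : IntervalIntegrable z volume s (s + t) := by
    have h1 : IntervalIntegrable x volume s (s + t) :=
      (hx s hs).1.symm.trans (hx (s + t) (by linarith)).1
    have h2 : IntervalIntegrable Y volume s (s + t) :=
      ContinuousOn.intervalIntegrable (by rwa [uIcc_of_le hst])
    refine (h1.sub h2).congr fun u hu => ?_
    rw [uIoc_of_le hst] at hu
    have := hxY u (hs.trans hu.1.le)
    simp only [this]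
    ring
  have hftc := intervalIntegral.integral_eq_sub_of_hasDeriv_right_of_le hst
    ((by fun_prop : Continuous fun u => Real.exp (k * u)).continuousOn.mul hYs) hder
    ((hzi.continuousOn_mul
      (by fun_prop : Continuous fun u => k * Real.exp (k * u)).continuousOn).neg)
  have hshift : ∫ u in (0 : ℝ)..t, k * Real.exp (-k * (t - u)) * z (s + u) =
      Real.exp (-k * (s + t)) * ∫ u in s..s + t, k * Real.exp (k * u) * z u := by
    rw [← intervalIntegral.integral_const_mul]
    have := intervalIntegral.integral_comp_add_left (a := 0) (b := t)
      (fun u => Real.exp (-k * (s + t)) * (k * Real.exp (k * u) * z u)) s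
    rw [add_zero] at this
    rw [← this]
    refine intervalIntegral.integral_congr fun u _ => ?_
    have : Real.exp (-k * (t - u)) = Real.exp (-k * (s + t)) * Real.exp (k * (s + u)) := by
      rw [← Real.exp_add]; ring_nf
    simp only [this]
    ring
  rw [intervalIntegral.integral_neg] at hftc
  rw [hshift, neg_eq_iff_eq_neg.1 hftc, hxY s hs, hxY (s + t) (by linarith)]
  have e1 : Real.exp (-k * (s + t)) * Real.exp (k * (s + t)) = 1 := by
    rw [← Real.exp_add]; simp
  have e2 : Real.exp (-k * (s + t)) * Real.exp (k * s) = Real.exp (-k * t) := by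
    rw [← Real.exp_add]; ring_nf
  simp only [Pi.mul_apply]
  linear_combination Y s * e2 - Y (s + t) * e1

/-- The weighted sums of increments approximate the solution of the Ornstein–Uhlenbeck equation. -/
lemma tendsto_sum_exp_mul_sub {k : ℝ} {z x : ℝ → ℝ} (hzm : Measurable z)
    (hz : ∀ u, 0 ≤ u → ContinuousWithinAt z (Ici u) u)
    (hx : ∀ t, 0 ≤ t → IntervalIntegrable x volume 0 t ∧
      x t = x 0 - k * (∫ u in (0 : ℝ)..t, x u) + z t)
    {s t C : ℝ} (hs : 0 ≤ s) (ht : 0 ≤ t) (hC : ∀ u ∈ Icc 0 (s + t), ‖z u‖ ≤ C) :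
    Filter.Tendsto (fun m : ℕ => ∑ i ∈ Finset.range (m + 1),
        Real.exp (-k * (t - t * i / (m + 1 : ℕ))) *
          (z (s + t * (i + 1 : ℕ) / (m + 1 : ℕ)) - z (s + t * i / (m + 1 : ℕ))))
      Filter.atTop (nhds (x (s + t) - Real.exp (-k * t) * x s)) := by
  have hW : ∀ u, HasDerivAt (fun u => Real.exp (-k * (t - u)))
      (k * Real.exp (-k * (t - u))) u := by
    intro u
    have := (((hasDerivAt_id u).const_sub t).const_mul (-k)).exp
    convert! this using 1
    simp [mul_comm]
  have hlim := tendsto_sum_sub_smul (T := t) ht hW (by fun_prop) (g := fun u => z (s + u)) (C := C)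
    (hzm.comp (measurable_const_add s)).stronglyMeasurable
    (fun u hu => hC _ ⟨by linarith [hu.1], by linarith [hu.2]⟩)
    (fun u hu => (hz (s + u) (by linarith [hu.1])).comp (by fun_prop)
      (fun v hv => by simpa using hv))
  rw [sub_exp_mul_eq_of_integral_equation
    (fun u hu => (hz u hu).mono Ioi_subset_Ici_self) hx hs ht]
  refine (hlim.const_sub (z (s + t) - Real.exp (-k * t) * z s)).congr fun m => ?_
  -- Summation by parts: weights at left endpoints pair the increments of the weight with `z` at
  -- right endpoints, as `tendsto_sum_sub_smul` requires.
  have htel := Finset.sum_range_sub (fun i : ℕ =>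
    Real.exp (-k * (t - t * i / (m + 1 : ℕ))) * z (s + t * i / (m + 1 : ℕ))) (m + 1)
  have e0 : t * ((0 : ℕ) : ℝ) / (m + 1 : ℕ) = 0 := by simp
  have eT : t * ((m + 1 : ℕ) : ℝ) / (m + 1 : ℕ) = t := by
    have : ((m + 1 : ℕ) : ℝ) ≠ 0 := by positivity
    field_simp
  rw [e0, eT] at htel
  simp only [sub_self, mul_zero, Real.exp_zero, one_mul, sub_zero, add_zero] at htel
  rw [← htel, ← Finset.sum_sub_distrib]
  refine Finset.sum_congr rfl fun i _ => ?_
  simp only [smul_eq_mul]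
  ring

/-! ### A common grid for `[0, s]` and `[s, s + t]`, and the limit of the characteristic functions.
-/

/-- The `i`-th point of the partition of `[0, s + t]` that cuts `[0, s]` and `[s, s + t]` into
`M` cells each. -/
noncomputable def gridTime (s t : ℝ≥0) (M i : ℕ) : ℝ≥0 :=
  s * (min i M : ℕ) / M + t * (i - M : ℕ) / M

lemma monotone_gridTime (s t : ℝ≥0) (M : ℕ) : Monotone (gridTime s t M) := by
  intro i j h
  unfold gridTime
  gcongr

/-- The weights `η exp(-k (s - u))` on `[0, s]` and `ξ exp(-k (s + t - u))` on `[s, s + t]`, at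
the points of the partition `gridTime`. -/
noncomputable def gridWeight (k : ℝ) (s t : ℝ≥0) (η ξ : ℝ) (M i : ℕ) : ℝ :=
  if i < M then η * Real.exp (-k * (s - s * i / M)) else
    ξ * Real.exp (-k * (t - t * (i - M : ℕ) / M))

lemma gridTime_of_le (s t : ℝ≥0) {M i : ℕ} (h : i ≤ M) : gridTime s t M i = s * i / M := by
  simp [gridTime, h]

lemma gridTime_add (s t : ℝ≥0) {M : ℕ} (hM : 0 < M) (i : ℕ) :
    gridTime s t M (M + i) = s + t * i / M := by
  have : (M : ℝ≥0) ≠ 0 := by exact_mod_cast hM.ne'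
  simp [gridTime, this]

lemma gridWeight_of_lt (k : ℝ) (s t : ℝ≥0) (η ξ : ℝ) {M i : ℕ} (h : i < M) :
    gridWeight k s t η ξ M i = η * Real.exp (-k * (s - s * i / M)) := by
  simp [gridWeight, h]

lemma gridWeight_add (k : ℝ) (s t : ℝ≥0) (η ξ : ℝ) (M i : ℕ) :
    gridWeight k s t η ξ M (M + i) = ξ * Real.exp (-k * (t - t * i / M)) := by
  simp [gridWeight]

/-- The `0 +` gives both halves the shape of `tendsto_sum_exp_mul_sub`, with starting times `0` and
`s`. -/
lemma incrementSum_gridTime {k : ℝ} (s t : ℝ≥0) (η ξ : ℝ) {M : ℕ} (hM : 0 < M) (c : ℝ≥0 → ℕ)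
    (j : ℕ → ℝ) {z : ℝ → ℝ} (hz : ∀ u : ℝ≥0, z u = ∑ i ∈ Finset.range (c u), j i) :
    incrementSum (gridTime s t M) (gridWeight k s t η ξ M) (M + M) (c, j) =
      η * ∑ i ∈ Finset.range M, Real.exp (-k * (s - s * i / M)) *
          (z (0 + s * (i + 1 : ℕ) / M) - z (0 + s * i / M)) +
        ξ * ∑ i ∈ Finset.range M, Real.exp (-k * (t - t * i / M)) *
          (z (s + t * (i + 1 : ℕ) / M) - z (s + t * i / M)) := by
  rw [incrementSum, Finset.sum_range_add, Finset.mul_sum, Finset.mul_sum]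
  simp only [← hz]
  congr 1
  · refine Finset.sum_congr rfl fun i hi => ?_
    rw [Finset.mem_range] at hi
    rw [gridWeight_of_lt _ _ _ _ _ hi, gridTime_of_le _ _ hi.le, gridTime_of_le _ _ hi]
    push_cast
    simp only [zero_add]
    ring
  · refine Finset.sum_congr rfl fun i hi => ?_
    rw [gridWeight_add, add_assoc, gridTime_add _ _ hM, gridTime_add _ _ hM]
    push_cast
    ring

lemma prod_gridTime {k : ℝ} (s t : ℝ≥0) (η ξ : ℝ) {M : ℕ} (hM : 0 < M) (F : ℝ → ℝ → ℂ) :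
    ∏ i ∈ Finset.range (M + M), F ((gridTime s t M (i + 1) : ℝ) - gridTime s t M i)
        (gridWeight k s t η ξ M i) =
      (∏ i ∈ Finset.range M, F ((s : ℝ) * (i + 1 : ℕ) / M - s * i / M)
          (η * Real.exp (-k * (s - s * i / M)))) *
        ∏ i ∈ Finset.range M, F ((t : ℝ) * (i + 1 : ℕ) / M - t * i / M)
          (ξ * Real.exp (-k * (t - t * i / M))) := by
  rw [Finset.prod_range_add]
  congr 1
  · refine Finset.prod_congr rfl fun i hi => ?_
    rw [Finset.mem_range] at hi
    rw [gridWeight_of_lt _ _ _ _ _ hi, gridTime_of_le _ _ hi.le, gridTime_of_le _ _ hi]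
    push_cast
    rfl
  · refine Finset.prod_congr rfl fun i hi => ?_
    rw [gridWeight_add, add_assoc, gridTime_add _ _ hM, gridTime_add _ _ hM]
    push_cast
    rw [add_sub_add_left_eq_sub]

/-- The product is the exponential of a Riemann sum. Reversing time, `u ↦ t - u`, turns its left
endpoints into right endpoints, so `tendsto_sum_sub_smul` applies with the identity as integrator.
-/
lemma tendsto_prod_cexp_charFun (μ : Measure ℝ) [IsProbabilityMeasure μ] (k lam ξ : ℝ) {t : ℝ}
    (ht : 0 ≤ t) :
    Filter.Tendsto (fun m : ℕ => ∏ i ∈ Finset.range (m + 1),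
        Complex.exp (lam * (t * (i + 1 : ℕ) / (m + 1 : ℕ) - t * i / (m + 1 : ℕ) : ℝ) *
          (charFun μ (ξ * Real.exp (-k * (t - t * i / (m + 1 : ℕ)))) - 1)))
      Filter.atTop (nhds (Complex.exp (lam *
        ∫ u in (0 : ℝ)..t, (charFun μ (ξ * Real.exp (-k * u)) - 1)))) := by
  have hgc : Continuous fun u : ℝ => charFun μ (ξ * Real.exp (-k * u)) - 1 := by
    have := continuous_charFun (μ := μ)
    fun_prop
  have hlim := tendsto_sum_sub_smul ht (fun u => hasDerivAt_id u) continuous_const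
    hgc.stronglyMeasurable (C := 2) (fun u _ => by
      refine (norm_sub_le _ _).trans ?_
      have := norm_charFun_le_one (μ := μ) (ξ * Real.exp (-k * u))
      rw [norm_one]
      linarith)
    (fun u _ => hgc.continuousAt.continuousWithinAt)
  simp only [one_smul] at hlim
  refine ((Complex.continuous_exp.tendsto _).comp (hlim.const_mul (lam : ℂ))).congr fun m => ?_
  rw [Function.comp_apply, ← Complex.exp_sum, ← Finset.sum_range_reflect, Finset.mul_sum]
  congr 1
  refine Finset.sum_congr rfl fun i hi => ?_
  have hi' : i ≤ m := Nat.lt_succ_iff.1 (Finset.mem_range.1 hi)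
  have hc : ((m + 1 - 1 - i : ℕ) : ℝ) = m - i := by
    rw [Nat.add_sub_cancel, Nat.cast_sub hi']
  have hm : ((m + 1 : ℕ) : ℝ) ≠ 0 := by positivity
  have h1 : t * ((m + 1 - 1 - i + 1 : ℕ) : ℝ) / (m + 1 : ℕ) = t - t * i / (m + 1 : ℕ) := by
    rw [Nat.cast_add, hc]
    field_simp
    push_cast
    ring
  have h2 : t * ((m + 1 - 1 - i + 1 : ℕ) : ℝ) / (m + 1 : ℕ)
      - t * ((m + 1 - 1 - i : ℕ) : ℝ) / (m + 1 : ℕ)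
      = t * (i + 1 : ℕ) / (m + 1 : ℕ) - t * i / (m + 1 : ℕ) := by
    push_cast
    ring
  simp only [id, h2, Complex.real_smul, mul_assoc]
  rw [h1]

/-- The Lévy–Khintchine exponent of the Ornstein–Uhlenbeck remainder, in closed form. -/
lemma cexp_integral_charFun_expMeasure {k lam β : ℝ} (hk : 0 < k) (hβ : 0 < β) {n : ℕ}
    (hn : lam / k = n) (t ξ : ℝ) :
    Complex.exp (lam * ∫ u in (0 : ℝ)..t, (charFun (expMeasure β) (ξ * Real.exp (-k * u)) - 1)) =
      ((β - Real.exp (-k * t) * ξ * Complex.I) / (β - ξ * Complex.I)) ^ n := by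
  set q : ℝ → ℂ := fun u => β - (ξ * Real.exp (-k * u) : ℝ) * Complex.I with hq
  have hq0 : ∀ u, q u ≠ 0 := fun u => ofReal_sub_mul_I_ne_zero hβ _
  have hk' : (k : ℂ) ≠ 0 := by exact_mod_cast hk.ne'
  have hqd : ∀ u, HasDerivAt q (k * ((ξ * Real.exp (-k * u) : ℝ) * Complex.I)) u := by
    intro u
    have h1 := ((((hasDerivAt_id u).const_mul (-k)).exp.const_mul ξ).ofReal_comp.mul_const
      Complex.I).const_sub (β : ℂ)
    convert! h1 using 1
    simp only [id]
    push_cast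
    ring
  have hqc : Continuous q := by fun_prop
  -- Here `φ(ξ e^{-ku}) - 1 = β/q - 1 = q'/(k q)`; the real part of `q` is `β > 0`, so the principal
  -- logarithm is differentiable along the path.
  have hlog : ∀ u, HasDerivAt (fun u => Complex.log (q u) / k)
      (charFun (expMeasure β) (ξ * Real.exp (-k * u)) - 1) u := by
    intro u
    have h1 := ((hqd u).clog_real (Or.inl (by
      rwa [hq, Complex.sub_re, Complex.ofReal_re, Complex.re_ofReal_mul, Complex.I_re, mul_zero,
        sub_zero]))).div_const (k : ℂ)
    convert! h1 using 1
    have hne := hq0 u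
    simp only [hq] at hne ⊢
    rw [charFun_expMeasure hβ, mul_div_assoc, mul_div_cancel_left₀ _ hk', div_sub_one hne,
      sub_sub_cancel]
  have := isProbabilityMeasure_expMeasure hβ
  have hgc : Continuous fun u : ℝ => charFun (expMeasure β) (ξ * Real.exp (-k * u)) - 1 := by
    have := continuous_charFun (μ := expMeasure β)
    fun_prop
  rw [intervalIntegral.integral_eq_sub_of_hasDerivAt (fun u _ => hlog u)
    (hgc.intervalIntegrable _ _)]
  have hlam : (lam : ℂ) = n * k := by
    rw [div_eq_iff hk.ne'] at hn
    rw [hn]; push_cast; rfl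
  have e : (lam : ℂ) * (Complex.log (q t) / k - Complex.log (q 0) / k)
      = n * (Complex.log (q t) - Complex.log (q 0)) := by
    rw [hlam]; field_simp
  rw [e, Complex.exp_nat_mul, Complex.exp_sub, Complex.exp_log (hq0 t), Complex.exp_log (hq0 0)]
  simp only [hq]
  simp [mul_comm]

/-! ### Factorisation of the joint characteristic function. -/

/-- The characteristic function of `(X s, X (t + s) - e^{-kt} X s)` as a product. -/
lemma IsGammaOU.exists_integral_cexp_eq {Ω : Type*} [MeasurableSpace Ω] {P : Measure Ω}
    [IsProbabilityMeasure P] {k lam β : ℝ} (hk : 0 < k) (hlam : 0 < lam) (hβ : 0 < β) {n : ℕ}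
    (hn : lam / k = n) {X : ℝ≥0 → Ω → ℝ} (hX : IsGammaOU k lam β X P) (s t : ℝ≥0) :
    ∃ H : ℝ → ℂ, ∀ η ξ : ℝ,
      ∫ ω, Complex.exp ((η * X s ω + ξ * (X (t + s) ω - Real.exp (-k * t) * X s ω) : ℝ) *
        Complex.I) ∂P =
      H η * ((β - Real.exp (-k * t) * ξ * Complex.I) / (β - ξ * Complex.I)) ^ n := by
  obtain ⟨hXm, N, J, hZ, hind, hsol⟩ := hX
  have := isProbabilityMeasure_expMeasure hβ
  -- `H` is the characteristic function of `X(s)`, seen as `e^{-ks}X(0)` plus the independent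
  -- remainder accumulated on `[0, s]`.
  refine ⟨fun η => charFun (P.map (X 0)) (η * Real.exp (-k * s)) * Complex.exp (lam *
    ∫ u in (0 : ℝ)..s, (charFun (expMeasure β) (η * Real.exp (-k * u)) - 1)), fun η ξ => ?_⟩
  rw [← cexp_integral_charFun_expMeasure hk hβ hn]
  set A : ℕ → Ω → ℝ := fun m ω => η * Real.exp (-k * s) * X 0 ω +
    incrementSum (gridTime s t (m + 1)) (gridWeight k s t η ξ (m + 1)) ((m + 1) + (m + 1))
      (fun t => N t ω, fun i => J i ω) with hA
  have hAm : ∀ m, Measurable (A m) := fun m => ((hXm 0).const_mul _).add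
    ((measurable_incrementSum _ _ _).comp hZ.measurable_prodMk)
  have hleft : Filter.Tendsto (fun m => ∫ ω, Complex.exp (A m ω * Complex.I) ∂P) Filter.atTop
      (nhds (∫ ω, Complex.exp ((η * X s ω + ξ * (X (t + s) ω - Real.exp (-k * t) * X s ω) : ℝ) *
        Complex.I) ∂P)) := by
    refine tendsto_integral_of_dominated_convergence (fun _ => 1)
      (fun m => by have := hAm m; fun_prop) (integrable_const _)
      (fun m => Filter.Eventually.of_forall fun ω => (Complex.norm_exp_ofReal_mul_I _).le) ?_
    filter_upwards [hZ.poisson.monotone, hZ.poisson.rightContinuous, hsol] with ω hmono hrc hω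
    have hcont : Continuous fun r : ℝ => Complex.exp (r * Complex.I) := by fun_prop
    refine (hcont.tendsto _).comp ?_
    set S : ℕ → ℝ := fun n => ∑ i ∈ Finset.range n, J i ω with hS
    set z : ℝ → ℝ := fun u => S (N u.toNNReal ω) with hz
    have hzm : Measurable z :=
      (measurable_of_countable S).comp (Monotone.measurable fun _ _ h => hmono (Real.toNNReal_mono h))
    have hzr : ∀ u, 0 ≤ u → ContinuousWithinAt z (Ici u) u := fun u _ =>
      (continuous_of_discreteTopology (f := S)).continuousAt.comp_continuousWithinAt
        ((hrc u.toNNReal).comp continuous_real_toNNReal.continuousWithinAt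
          (fun v hv => Real.toNNReal_mono hv))
    have hx : ∀ r : ℝ, 0 ≤ r → IntervalIntegrable (fun u => X u.toNNReal ω) volume 0 r ∧
        X r.toNNReal ω = X (0 : ℝ).toNNReal ω - k * (∫ u in (0 : ℝ)..r, X u.toNNReal ω) + z r := by
      intro r hr
      have h := hω r.toNNReal
      rw [Real.coe_toNNReal r hr] at h
      rw [Real.toNNReal_zero]
      exact h
    -- On `[0, T]` the monotone path of `N` takes only values up to `N T`, so `z` takes finitely
    -- many values there.
    have hzC : ∀ T : ℝ, ∃ C, ∀ u ∈ Icc 0 T, ‖z u‖ ≤ C := by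
      intro T
      refine ⟨∑ i ∈ Finset.range (N T.toNNReal ω + 1), ‖S i‖, fun u hu => ?_⟩
      exact Finset.single_le_sum (f := fun i => ‖S i‖) (fun i _ => norm_nonneg _)
        (Finset.mem_range.2 (Nat.lt_succ_of_le (hmono (Real.toNNReal_mono hu.2))))
    obtain ⟨C₁, hC₁⟩ := hzC (0 + s)
    obtain ⟨C₂, hC₂⟩ := hzC (s + t)
    have h1 := tendsto_sum_exp_mul_sub hzm hzr hx le_rfl s.coe_nonneg hC₁
    have h2 := tendsto_sum_exp_mul_sub hzm hzr hx s.coe_nonneg t.coe_nonneg hC₂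
    have h3 := ((h1.const_mul η).add (h2.const_mul ξ)).const_add (η * Real.exp (-k * s) * X 0 ω)
    have hst : ((s : ℝ) + t).toNNReal = t + s := by
      rw [← NNReal.coe_add, Real.toNNReal_coe, add_comm]
    simp only [zero_add, hst, Real.toNNReal_coe, Real.toNNReal_zero] at h3
    convert! h3 using 2 with m
    · simp only [hA]
      rw [incrementSum_gridTime s t η ξ m.succ_pos _ _ (z := z) (fun u => by
        simp only [hz, hS, Real.toNNReal_coe])]
      simp only [zero_add]
    · ring
  have hright : Filter.Tendsto (fun m => ∫ ω, Complex.exp (A m ω * Complex.I) ∂P) Filter.atTop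
      (nhds (charFun (P.map (X 0)) (η * Real.exp (-k * s)) * (Complex.exp (lam *
        ∫ u in (0 : ℝ)..s, (charFun (expMeasure β) (η * Real.exp (-k * u)) - 1)) *
        Complex.exp (lam *
        ∫ u in (0 : ℝ)..t, (charFun (expMeasure β) (ξ * Real.exp (-k * u)) - 1))))) := by
    refine (((tendsto_prod_cexp_charFun (expMeasure β) k lam η s.coe_nonneg).mul
      (tendsto_prod_cexp_charFun (expMeasure β) k lam ξ t.coe_nonneg)).const_mul _).congr fun m => ?_
    rw [hZ.integral_cexp_add_incrementSum hlam.le (hXm 0) hind (monotone_gridTime s t (m + 1)),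
      prod_gridTime s t η ξ m.succ_pos
        (fun d w => Complex.exp (lam * (d : ℝ) * (charFun (expMeasure β) w - 1)))]
  rw [mul_assoc]
  exact tendsto_nhds_unique hleft hright

/-! ### From independence to the conditional law. -/

/-- The joint law of `(Y, aY + R)` is the image of a product measure under `(y, r) ↦ (y, ay + r)`,
so it disintegrates over `Y` into translates of the law of `R`; uniqueness of disintegration
concludes. -/
lemma condDistrib_const_mul_add_of_indepFun {Ω : Type*} [MeasurableSpace Ω] {P : Measure Ω}
    [IsProbabilityMeasure P] {Y R : Ω → ℝ} (hY : Measurable Y) (hR : Measurable R)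
    (hYR : IndepFun Y R P) (a : ℝ) :
    ∀ᵐ y ∂(P.map Y), condDistrib (fun ω => a * Y ω + R ω) Y P y = (P.map R).map (a * y + ·) := by
  have := Measure.isProbabilityMeasure_map (μ := P) hY.aemeasurable
  have := Measure.isProbabilityMeasure_map (μ := P) hR.aemeasurable
  have hf : Measurable fun p : ℝ × ℝ => a * p.1 + p.2 := by fun_prop
  set κ : Kernel ℝ ℝ := (Kernel.id ×ₖ Kernel.const ℝ (P.map R)).map fun p => a * p.1 + p.2 with hκ
  have hκa : ∀ y, κ y = (P.map R).map (a * y + ·) := by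
    intro y
    rw [hκ, Kernel.map_apply _ hf, Kernel.prod_apply, Kernel.id_apply, Kernel.const_apply,
      Measure.dirac_prod, Measure.map_map hf measurable_prodMk_left]
    rfl
  have : IsMarkovKernel κ := Kernel.IsMarkovKernel.map _ hf
  have key : P.map (fun ω => (Y ω, a * Y ω + R ω)) = P.map Y ⊗ₘ κ := by
    have hg : Measurable fun p : ℝ × ℝ => (p.1, a * p.1 + p.2) := by fun_prop
    have h1 : P.map (fun ω => (Y ω, a * Y ω + R ω)) =
        ((P.map Y).prod (P.map R)).map fun p => (p.1, a * p.1 + p.2) := by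
      rw [← (indepFun_iff_map_prod_eq_prod_map_map hY.aemeasurable hR.aemeasurable).1 hYR,
        Measure.map_map hg (hY.prodMk hR)]
      rfl
    rw [h1]
    ext S hS
    rw [Measure.map_apply hg hS, Measure.prod_apply (hg hS), Measure.compProd_apply hS]
    refine lintegral_congr fun y => ?_
    rw [hκa, Measure.map_apply (measurable_const_add _) (measurable_prodMk_left hS)]
    rfl
  filter_upwards [condDistrib_ae_eq_of_measure_eq_compProd Y (by fun_prop) key] with y hy
  rw [hy, hκa]

theorem mainTheorem9 {Ω : Type*} [MeasurableSpace Ω] (P : Measure Ω) [IsProbabilityMeasure P]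
    (k lam β : ℝ) (hk : 0 < k) (hlam : 0 < lam) (hβ : 0 < β)
    (n : ℕ) (hn : 1 ≤ n) (hlamk : lam / k = n)
    (X : ℝ≥0 → Ω → ℝ) (hX : IsGammaOU k lam β X P)
    (s t : ℝ≥0) (ht : 0 < t) :
    ∀ᵐ y ∂(P.map (X s)),
      condDistrib (X (t + s)) (X s) P y =
        erlangRemainderLaw (Real.exp (-k * t)) n β (Real.exp (-k * t) * y) := by
  obtain ⟨H, hH⟩ := hX.exists_integral_cexp_eq hk hlam hβ hlamk s t
  have ha0 : 0 ≤ Real.exp (-k * t) := (Real.exp_pos _).le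
  have ha1 : Real.exp (-k * t) ≤ 1 := Real.exp_le_one_iff.2 (by
    have : 0 ≤ k * t := mul_nonneg hk.le t.coe_nonneg
    linarith)
  set a := Real.exp (-k * t) with ha
  set R : Ω → ℝ := fun ω => X (t + s) ω - a * X s ω with hR
  have hXs : Measurable (X s) := hX.1 s
  have hRm : Measurable R := (hX.1 (t + s)).sub (hXs.const_mul a)
  set B : ℝ → ℂ := fun ξ => ((β - a * ξ * Complex.I) / (β - ξ * Complex.I)) ^ n with hB
  have hβ' : (β : ℂ) ≠ 0 := by exact_mod_cast hβ.ne'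
  have hB0 : B 0 = 1 := by simp [hB, hβ']
  -- Setting either frequency to zero identifies `H` and `B` as the two marginal characteristic
  -- functions.
  have hH0 : H 0 = 1 := by
    have h := hH 0 0
    change _ = H 0 * B 0 at h
    simpa [hB0] using h.symm
  have hcharX : ∀ η, charFun (P.map (X s)) η = H η := by
    intro η
    have h := hH η 0
    change _ = H η * B 0 at h
    rw [hB0, mul_one] at h
    rw [charFun_apply_real, integral_map hXs.aemeasurable (by fun_prop), ← h]
    simp
  have hcharR : ∀ ξ, charFun (P.map R) ξ = B ξ := by
    intro ξ
    have h := hH 0 ξ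
    change _ = H 0 * B ξ at h
    rw [hH0, one_mul] at h
    rw [charFun_apply_real, integral_map hRm.aemeasurable (by fun_prop), ← h]
    simp [hR]
  have hind : IndepFun (X s) R P := by
    -- Kac's criterion: a joint characteristic function equal to the product of the marginal ones
    -- means independence.
    rw [indepFun_iff_charFun_prod hXs.aemeasurable hRm.aemeasurable]
    intro v
    rw [hcharX, hcharR, charFun_apply,
      integral_map (φ := fun ω => WithLp.toLp 2 (X s ω, R ω)) (by fun_prop) (by fun_prop)]
    refine Eq.trans ?_ (hH _ _)
    refine integral_congr_ae (Filter.Eventually.of_forall fun ω => ?_)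
    simp only [WithLp.prod_inner_apply, Real.inner_apply, hR]
    ring_nf
  have hXR : X (t + s) = fun ω => a * X s ω + R ω := by
    funext ω
    simp [hR]
  have hlaw : ∀ y, (P.map R).map (a * y + ·) = erlangRemainderLaw a n β (a * y) := by
    intro y
    have := Measure.isProbabilityMeasure_map (μ := P) hRm.aemeasurable
    have := Measure.isProbabilityMeasure_map (μ := P.map R)
      (measurable_const_add (a * y)).aemeasurable
    have := isFiniteMeasure_erlangRemainderLaw ha0 ha1 n hβ (a * y)
    refine Measure.ext_of_charFun (funext fun ξ => ?_)
    rw [charFun_map_const_add, hcharR, charFun_erlangRemainderLaw ha0 ha1 n hβ]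
    simp [hB, mul_comm]
  rw [hXR]
  filter_upwards [condDistrib_const_mul_add_of_indepFun hXs hRm hind a] with y hy
  rw [hy, hlaw]
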